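/- Let $r>g\ge 1$ be integers and let $K_{r,g}$ be the complete bipartite graph with $r$ red and $g$ green vertices. Let $\mathcal T$ be its universal cover, i.e. the tree in which every red vertex has $g$ neighbours, all green, and every green vertex has $r$ neighbours, all red. Let $H$ be the periodic Jacobi matrix on $\ell^2(\mathcal T)=\ell^2(\mathcal T;\mathbb C)$ with all edge parameters $a=1$ and all vertex parameters $b=0$, that is, $(H\varphi)(x)=\sum_{y\sim x}\varphi(y)$. Fix a red vertex $o$ of $\mathcal T$ and let $u$ be the radial function about $o$ given, in terms of the graph distance $d$ of $\mathcal T$, by $$u(x)=0\ \text{ if } d(o,x) \text{ is odd},\qquad u(x)=\Bigl(-\frac1{r-1}\Bigr)^{k}\ \text{ if } d(o,x)=2k,\quad k=0,1,2,\dots$$ Then $u\in\ell^2(\mathcal T)$ and $Hu=0$. The automorphism group of $\mathcal T$ acts transitively on the red vertices. Let $\mathcal S$ be the automorphism group of $\mathcal T$ or, more generally, any group of automorphisms of $\mathcal T$ that acts transitively on the red vertices. Then the translates $u\circ\gamma^{-1}$, $\gamma\in\mathcal S$, span $\ker(H)$: the closed linear span of these translates is $\ker(H)$, and any $\varphi\in\ker(H)$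 that is orthogonal to $u\circ\gamma^{-1}$ for every $\gamma\in\mathcal S$ is zero. -/

import Mathlib

/-- A vertex of the universal cover of the graph `G` with base point `x₀`: a walk in `G` starting
at `x₀` in which no step is followed by the reverse step. (In a graph these are the homotopy
classes of paths starting at `x₀`.) -/
structure CoverVertex {V : Type*} (G : SimpleGraph V) (x₀ : V) where
  /-- the vertex of `G` below this vertex, i.e. its image under the covering map -/
  proj : V
  /-- the walk from the base point -/
  walk : G.Walk x₀ proj
  reduced : walk.darts.IsChain (fun d e => e ≠ d.symm)

namespace CoverVertex

variable {V : Type*} {G : SimpleGraph V} {x₀ : V}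

/-- `y` prolongs `x` by a single step. -/
def IsChild (x y : CoverVertex G x₀) : Prop :=
  ∃ h : G.Adj x.proj y.proj, y.walk = x.walk.concat h

theorem IsChild.adj {x y : CoverVertex G x₀} (h : x.IsChild y) : G.Adj x.proj y.proj := h.1

theorem eq_of_concat {x y : CoverVertex G x₀} {w : V} (hx : G.Adj x.proj w)
    (hy : G.Adj y.proj w) (h : x.walk.concat hx = y.walk.concat hy) : x = y := by
  obtain ⟨p, wx, cx⟩ := x
  obtain ⟨q, wy, cy⟩ := y
  obtain ⟨hv, hw⟩ := SimpleGraph.Walk.concat_inj h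
  dsimp only at hv hw
  subst hv
  simp only [SimpleGraph.Walk.copy_rfl_rfl] at hw
  subst hw
  rfl

theorem IsChild.unique_parent {x x' y : CoverVertex G x₀} (h : x.IsChild y) (h' : x'.IsChild y) :
    x = x' := by
  obtain ⟨a, e⟩ := h
  obtain ⟨a', e'⟩ := h'
  exact eq_of_concat a a' (e.symm.trans e')

theorem IsChild.unique_child {x y y' : CoverVertex G x₀} (h : x.IsChild y) (h' : x.IsChild y')
    (hp : y.proj = y'.proj) : y = y' := by
  obtain ⟨p, w, c⟩ := y
  obtain ⟨p', w', c'⟩ := y'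
  obtain ⟨a, e⟩ := h
  obtain ⟨a', e'⟩ := h'
  dsimp only at hp a e a' e'
  subst hp
  subst e
  subst e'
  rfl

theorem IsChild.proj_ne {x y z : CoverVertex G x₀} (h : x.IsChild y) (h' : y.IsChild z) :
    z.proj ≠ x.proj := by
  obtain ⟨p, w, c⟩ := y
  obtain ⟨p', w', c'⟩ := z
  obtain ⟨a, e⟩ := h
  obtain ⟨a', e'⟩ := h'
  dsimp only at a e a' e' ⊢
  subst e
  subst e'
  rintro rfl
  rw [SimpleGraph.Walk.darts_concat, SimpleGraph.Walk.darts_concat, List.concat_eq_append,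
    List.concat_eq_append, List.append_assoc] at c'
  have := c'.right_of_append
  simp [SimpleGraph.Dart.symm] at this

end CoverVertex

/-- The universal cover of `G`: two reduced walks are adjacent if one of them prolongs the other
by a single step. -/
def universalCover {V : Type*} (G : SimpleGraph V) (x₀ : V) :
    SimpleGraph (CoverVertex G x₀) where
  Adj x y := x.IsChild y ∨ y.IsChild x
  symm := ⟨fun _ _ h => h.symm⟩
  loopless := ⟨fun _ h => h.elim (fun k => k.adj.ne rfl) (fun k => k.adj.ne rfl)⟩

namespace CoverVertex

variable {V : Type*} {G : SimpleGraph V} {x₀ : V}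

/-- The covering map is injective on the neighbours of every vertex. -/
theorem proj_injOn_neighborSet (x : CoverVertex G x₀) :
    Set.InjOn proj ((universalCover G x₀).neighborSet x) := by
  rintro y (hy | hy) z (hz | hz) h
  · exact hy.unique_child hz h
  · exact absurd h (hz.proj_ne hy)
  · exact absurd h.symm (hy.proj_ne hz)
  · exact hy.unique_parent hz

noncomputable instance [Fintype V] (x : CoverVertex G x₀) :
    Fintype ((universalCover G x₀).neighborSet x) :=
  Fintype.ofInjective (fun y => (y : CoverVertex G x₀).proj)
    (fun y z h => Subtype.ext (proj_injOn_neighborSet x y.2 z.2 h))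

theorem card_neighborFinset_le [Fintype V] (x : CoverVertex G x₀) :
    ((universalCover G x₀).neighborFinset x).card ≤ Fintype.card V := by
  classical
  refine Finset.card_le_card_of_injOn proj (fun _ _ => Finset.mem_univ _) ?_
  simpa using proj_injOn_neighborSet x

end CoverVertex

/-- The Hilbert space of square-summable complex functions on `X`. -/
noncomputable abbrev EllTwo (X : Type*) := lp (fun _ : X => ℂ) 2

theorem memℓp_two_comp_equiv {X : Type*} {f : X → ℂ} (hf : Memℓp f 2) (e : X ≃ X) :
    Memℓp (fun x => f (e x)) 2 := by
  rw [memℓp_gen_iff (by simp)] at hf ⊢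
  exact (e.summable_iff (f := fun x => ‖f x‖ ^ (2 : ENNReal).toReal)).2 hf

/-- The translate `x ↦ f (γ⁻¹ x)` of a square-summable function by a graph automorphism. -/
noncomputable def ellTranslate {X : Type*} {T : SimpleGraph X} (γ : T ≃g T) (f : EllTwo X) : EllTwo X :=
  ⟨fun x => f (γ.symm x), memℓp_two_comp_equiv f.2 γ.symm.toEquiv⟩

section Jacobi

variable {V : Type*} [Fintype V] (G : SimpleGraph V) (x₀ : V)

/-- The action on functions of the lift to the universal cover of the Jacobi matrix on `G` with
edge parameters `a` and vertex parameters `b`. (Only the values of `a` at edges of `G` matter.) -/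
noncomputable def jacobiAction (a : Sym2 V → ℝ) (b : V → ℝ) (f : CoverVertex G x₀ → ℂ)
    (x : CoverVertex G x₀) : ℂ :=
  (b x.proj : ℂ) * f x +
    ∑ y ∈ (universalCover G x₀).neighborFinset x, (a s(x.proj, y.proj) : ℂ) * f y

/-- A bound for the norm of the periodic Jacobi matrix. -/
noncomputable def jacobiBound (a : Sym2 V → ℝ) (b : V → ℝ) : ℝ :=
  2 * (∑ e, |a e| + ∑ v, |b v|) * (1 + Fintype.card V)

theorem jacobiBound_nonneg (a : Sym2 V → ℝ) (b : V → ℝ) : 0 ≤ jacobiBound a b := by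
  unfold jacobiBound; positivity

theorem norm_jacobiAction_sq_le (a : Sym2 V → ℝ) (b : V → ℝ) (f : CoverVertex G x₀ → ℂ)
    (x : CoverVertex G x₀) :
    ‖jacobiAction G x₀ a b f x‖ ^ 2 ≤ 2 * (∑ e, |a e| + ∑ v, |b v|) ^ 2 *
      (‖f x‖ ^ 2 + Fintype.card V * ∑ y ∈ (universalCover G x₀).neighborFinset x, ‖f y‖ ^ 2) := by
  set K := ∑ e, |a e| + ∑ v, |b v| with hK
  set N := (universalCover G x₀).neighborFinset x
  have ha : ∀ e, |a e| ≤ K := fun e =>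
    (Finset.single_le_sum (f := fun e => |a e|) (fun _ _ => abs_nonneg _)
      (Finset.mem_univ e)).trans (le_add_of_nonneg_right (by positivity))
  have hb : ∀ v, |b v| ≤ K := fun v =>
    (Finset.single_le_sum (f := fun v => |b v|) (fun _ _ => abs_nonneg _)
      (Finset.mem_univ v)).trans (le_add_of_nonneg_left (by positivity))
  have h1 : ‖jacobiAction G x₀ a b f x‖ ≤ K * (‖f x‖ + ∑ y ∈ N, ‖f y‖) := by
    unfold jacobiAction
    refine (norm_add_le _ _).trans ?_
    rw [mul_add, Finset.mul_sum]
    refine add_le_add ?_ ((norm_sum_le _ _).trans (Finset.sum_le_sum fun y _ => ?_))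
    · rw [norm_mul, Complex.norm_real, Real.norm_eq_abs]
      exact mul_le_mul_of_nonneg_right (hb _) (norm_nonneg _)
    · rw [norm_mul, Complex.norm_real, Real.norm_eq_abs]
      exact mul_le_mul_of_nonneg_right (ha _) (norm_nonneg _)
  have h2 : (∑ y ∈ N, ‖f y‖) ^ 2 ≤ Fintype.card V * ∑ y ∈ N, ‖f y‖ ^ 2 := by
    refine sq_sum_le_card_mul_sum_sq.trans ?_
    exact mul_le_mul_of_nonneg_right
      (by exact_mod_cast CoverVertex.card_neighborFinset_le x) (by positivity)
  calc ‖jacobiAction G x₀ a b f x‖ ^ 2 ≤ (K * (‖f x‖ + ∑ y ∈ N, ‖f y‖)) ^ 2 := by gcongr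
    _ ≤ K ^ 2 * (2 * (‖f x‖ ^ 2 + (∑ y ∈ N, ‖f y‖) ^ 2)) := by
        rw [mul_pow]
        exact mul_le_mul_of_nonneg_left (add_sq_le ..) (by positivity)
    _ ≤ K ^ 2 * (2 * (‖f x‖ ^ 2 + Fintype.card V * ∑ y ∈ N, ‖f y‖ ^ 2)) := by gcongr
    _ = _ := by ring

theorem sum_norm_jacobiAction_sq_le (a : Sym2 V → ℝ) (b : V → ℝ) (f : EllTwo (CoverVertex G x₀))
    (s : Finset (CoverVertex G x₀)) :
    ∑ x ∈ s, ‖jacobiAction G x₀ a b f x‖ ^ (2 : ENNReal).toReal ≤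
      (jacobiBound a b * ‖f‖) ^ (2 : ENNReal).toReal := by
  classical
  have hf : ∀ t : Finset (CoverVertex G x₀), ∑ x ∈ t, ‖f x‖ ^ 2 ≤ ‖f‖ ^ 2 := fun t => by
    simpa using lp.sum_rpow_le_norm_rpow (p := 2) (by simp) f t
  set D : ℝ := (Fintype.card V : ℝ) with hD
  set N := fun x => (universalCover G x₀).neighborFinset x with hN
  have h1 : ∑ x ∈ s, ∑ y ∈ N x, ‖f y‖ ^ 2 ≤ D * ‖f‖ ^ 2 := by
    rw [Finset.sum_comm' (t' := s.biUnion N) (s' := fun y => s.filter (fun x => x ∈ N y))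
      (by
        intro x y
        simp only [Finset.mem_filter, Finset.mem_biUnion, hN, SimpleGraph.mem_neighborFinset]
        exact ⟨fun h => ⟨⟨h.1, h.2.symm⟩, x, h⟩, fun h => ⟨h.1.1, h.1.2.symm⟩⟩)]
    calc ∑ y ∈ s.biUnion N, ∑ x ∈ s.filter (fun x => x ∈ N y), ‖f y‖ ^ 2
        ≤ ∑ y ∈ s.biUnion N, D * ‖f y‖ ^ 2 := by
          refine Finset.sum_le_sum fun y _ => ?_
          rw [Finset.sum_const, nsmul_eq_mul]
          refine mul_le_mul_of_nonneg_right ?_ (by positivity)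
          have : (s.filter (fun x => x ∈ N y)).card ≤ (N y).card :=
            Finset.card_le_card fun x hx => (Finset.mem_filter.1 hx).2
          exact (Nat.cast_le (α := ℝ)).2 (this.trans (CoverVertex.card_neighborFinset_le y))
      _ ≤ D * ‖f‖ ^ 2 := by
          rw [← Finset.mul_sum]
          exact mul_le_mul_of_nonneg_left (hf _) (by positivity)
  simp only [ENNReal.toReal_ofNat, Real.rpow_two]
  have hD0 : 0 ≤ D := by positivity
  set K := ∑ e, |a e| + ∑ v, |b v| with hK
  calc ∑ x ∈ s, ‖jacobiAction G x₀ a b f x‖ ^ 2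
      ≤ ∑ x ∈ s, 2 * K ^ 2 * (‖f x‖ ^ 2 + D * ∑ y ∈ N x, ‖f y‖ ^ 2) :=
        Finset.sum_le_sum fun x _ => norm_jacobiAction_sq_le G x₀ a b f x
    _ = 2 * K ^ 2 * (∑ x ∈ s, ‖f x‖ ^ 2 + D * ∑ x ∈ s, ∑ y ∈ N x, ‖f y‖ ^ 2) := by
        rw [← Finset.mul_sum, Finset.sum_add_distrib, Finset.mul_sum s]
    _ ≤ 2 * K ^ 2 * (‖f‖ ^ 2 + D * (D * ‖f‖ ^ 2)) := by
        gcongr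
        exact hf s
    _ ≤ (jacobiBound a b * ‖f‖) ^ 2 := by
        have : (jacobiBound a b * ‖f‖) ^ 2 = 4 * K ^ 2 * (1 + D) ^ 2 * ‖f‖ ^ 2 := by
          unfold jacobiBound; ring
        rw [this]
        have h0 : 0 ≤ K ^ 2 * ‖f‖ ^ 2 := by positivity
        nlinarith [mul_nonneg h0 hD0, mul_nonneg h0 (sq_nonneg D)]

/-- The periodic Jacobi matrix: the lift to `ℓ²` of the universal cover of the Jacobi matrix on
the finite graph `G` with edge parameters `a` and vertex parameters `b`. -/
noncomputable def periodicJacobi (a : Sym2 V → ℝ) (b : V → ℝ) :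
    EllTwo (CoverVertex G x₀) →L[ℂ] EllTwo (CoverVertex G x₀) :=
  LinearMap.mkContinuous
    { toFun := fun f => ⟨jacobiAction G x₀ a b f,
        memℓp_gen' (sum_norm_jacobiAction_sq_le G x₀ a b f)⟩
      map_add' := fun f g => by
        ext x
        simp only [jacobiAction, lp.coeFn_add, Pi.add_apply, mul_add, Finset.sum_add_distrib]
        ring
      map_smul' := fun c f => by
        ext x
        simp only [jacobiAction, lp.coeFn_smul, Pi.smul_apply, smul_eq_mul, RingHom.id_apply,
          mul_add, Finset.mul_sum, mul_left_comm] }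
    (jacobiBound a b)
    (fun f => lp.norm_le_of_forall_sum_le (by simp)
      (mul_nonneg (jacobiBound_nonneg a b) (norm_nonneg f))
      (sum_norm_jacobiAction_sq_le G x₀ a b f))

end Jacobi

/-! ### The `rg`-model -/

/-- The complete bipartite graph with `r` red vertices (left) and `g` green vertices (right). -/
abbrev rgGraph (r g : ℕ) : SimpleGraph (Fin r ⊕ Fin g) :=
  completeBipartiteGraph (Fin r) (Fin g)

/-- The vertices of the universal cover of the complete bipartite graph, with a red base point. -/
abbrev RGVertex (r g : ℕ) (x₀ : Fin r) := CoverVertex (rgGraph r g) (Sum.inl x₀)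

/-- The universal cover of the complete bipartite graph, with a red base point. -/
abbrev rgTree (r g : ℕ) (x₀ : Fin r) : SimpleGraph (RGVertex r g x₀) :=
  universalCover (rgGraph r g) (Sum.inl x₀)

/-- A vertex of the tree is red if it lies over one of the `r` red vertices. -/
def IsRed {r g : ℕ} {x₀ : Fin r} (x : RGVertex r g x₀) : Prop := x.proj.isLeft

/-- The operator of the `rg`-model: the periodic Jacobi matrix with all `a = 1` and all `b = 0`. -/
noncomputable def rgOperator (r g : ℕ) (x₀ : Fin r) :
    EllTwo (RGVertex r g x₀) →L[ℂ] EllTwo (RGVertex r g x₀) :=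
  periodicJacobi (rgGraph r g) (Sum.inl x₀) (fun _ => 1) (fun _ => 0)

/-- The radial function centered at `o`: it is `0` on the odd levels and `(-1/(r-1))^k` on the
level `2k`, the level of a vertex being its distance from `o` in the tree. -/
noncomputable def radialFunction {r g : ℕ} {x₀ : Fin r} (o x : RGVertex r g x₀) : ℂ :=
  if Even ((rgTree r g x₀).dist o x) then
    (-1 / ((r : ℂ) - 1)) ^ ((rgTree r g x₀).dist o x / 2)
  else 0

/-- A group of automorphisms of the tree is transitive on the red vertices. -/
def IsTransitiveOnRed {r g : ℕ} {x₀ : Fin r} (S : Subgroup (rgTree r g x₀ ≃g rgTree r g x₀)) :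
    Prop :=
  ∀ x y : RGVertex r g x₀, IsRed x → IsRed y → ∃ γ ∈ S, γ x = y

/-! Let `φ ∈ ker H`, let `y` be any vertex and `p` its degree. Each child `z` of a vertex `x`
satisfies `φ x + ∑ φ(children of z) = 0`, so the sums of `φ` over the even spheres about `y` obey a
two-step recursion, and the sum over the sphere of radius `2(k+1)` is `-p (-(p-1))^k φ y`
(`sum_sphere_even`). Pairing `φ` with the radial function `u_y` about `y` gives `⟨u_y, φ⟩ - φ y = ∑ₖ
p/(r-1) ((p-1)/(r-1))^k φ y` (`hasSum_radialFunction`), valid for both colours because `u_y` is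
always square-summable.

At a green `y`, `p = r` and the terms are constant, so convergence forces `φ y = 0`. At a red `y`,
`p = g < r` and the geometric series gives `⟨u_y, φ⟩ = r/(r-g) φ y`. The translates of `u` include
all `u_y` with `y` red, so an element of the kernel orthogonal to them vanishes; orthogonal
decomposition then gives density of their span.

The geometric input is that the universal cover looks like a rooted tree from every vertex. This is
clear from the root and is carried to other vertices by lifts of the identity; lifts of other
automorphisms give transitivity (`exists_iso`). -/

theorem SimpleGraph.Iso.dist_apply {X Y : Type*} {T : SimpleGraph X} {T' : SimpleGraph Y}
    (e : T ≃g T') (x y : X) : T'.dist (e x) (e y) = T.dist x y := by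
  by_cases h : T.Reachable x y
  · obtain ⟨p, hp⟩ := h.exists_walk_length_eq_dist
    obtain ⟨q, hq⟩ := (e.reachable_iff.2 h).exists_walk_length_eq_dist
    refine le_antisymm ?_ ?_
    · rw [← hp, ← SimpleGraph.Walk.length_map e.toHom p]
      exact SimpleGraph.dist_le _
    · have h2 := SimpleGraph.dist_le (q.map e.symm.toHom)
      rw [SimpleGraph.Walk.length_map, hq] at h2
      change T.dist (e.symm (e x)) (e.symm (e y)) ≤ _ at h2
      rwa [e.symm_apply_apply, e.symm_apply_apply] at h2
  · rw [SimpleGraph.dist_eq_zero_of_not_reachable h,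
      SimpleGraph.dist_eq_zero_of_not_reachable (mt e.reachable_iff.1 h)]

/-! ### Lifts to universal covers and the tree structure -/

namespace CoverVertex

variable {V : Type*} {G : SimpleGraph V}

/-- The constant walk, as a vertex of the universal cover. -/
def root (G : SimpleGraph V) (a : V) : CoverVertex G a := ⟨a, .nil, by simp⟩

theorem eq_root_or_exists_isChild {a : V} (x : CoverVertex G a) :
    x = root G a ∨ ∃ y : CoverVertex G a, y.IsChild x := by
  obtain ⟨p, w, c⟩ := x
  cases w with
  | nil => exact .inl rfl
  | cons h q =>
    obtain ⟨t, q', h', e⟩ := SimpleGraph.Walk.exists_cons_eq_concat h q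
    refine .inr ⟨⟨t, q', ?_⟩, h', e⟩
    rw [e, SimpleGraph.Walk.darts_concat, List.concat_eq_append] at c
    exact c.left_of_append

theorem IsChild.length_eq {a : V} {x y : CoverVertex G a} (h : x.IsChild y) :
    y.walk.length = x.walk.length + 1 := by
  obtain ⟨k, e⟩ := h
  rw [e, SimpleGraph.Walk.length_concat]

theorem not_isChild_root {a : V} (x : CoverVertex G a) : ¬ x.IsChild (root G a) := fun h => by
  have := h.length_eq
  simp [root] at this

@[elab_as_elim]
theorem induction_on_isChild {a : V} {P : CoverVertex G a → Prop} (x : CoverVertex G a)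
    (base : P (root G a)) (step : ∀ x y : CoverVertex G a, x.IsChild y → P x → P y) : P x := by
  induction hn : x.walk.length generalizing x with
  | zero =>
    obtain rfl | ⟨y, hy⟩ := x.eq_root_or_exists_isChild
    · exact base
    · have := hy.length_eq; omega
  | succ n ih =>
    obtain rfl | ⟨y, hy⟩ := x.eq_root_or_exists_isChild
    · exact base
    · exact step y x hy (ih y (by have := hy.length_eq; omega))

/-- The covering map is surjective on the neighbours of every vertex. -/
theorem exists_adj_proj_eq {a : V} (x : CoverVertex G a) {w : V} (h : G.Adj x.proj w) :
    ∃ y, (universalCover G a).Adj x y ∧ y.proj = w := by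
  obtain rfl | ⟨z, hz⟩ := x.eq_root_or_exists_isChild
  · exact ⟨⟨w, .cons h .nil, List.isChain_singleton _⟩, .inl ⟨h, rfl⟩, rfl⟩
  by_cases hw : z.proj = w
  · exact ⟨z, .inr hz, hw⟩
  obtain ⟨p, W, c⟩ := x
  obtain ⟨k, e⟩ := hz
  dsimp only at h k e
  subst e
  -- The prolonged walk stays reduced: a backtracking last step would end over `z.proj`, which is
  -- not `w`.
  refine ⟨⟨w, (z.walk.concat k).concat h, ?_⟩, .inl ⟨h, rfl⟩, rfl⟩
  rw [SimpleGraph.Walk.darts_concat, List.concat_eq_append]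
  refine List.isChain_append.2 ⟨c, by simp, ?_⟩
  simp only [SimpleGraph.Walk.darts_concat, List.concat_eq_append]
  rintro d hd e he rfl
  simp at hd he
  subst hd
  simp [SimpleGraph.Dart.symm] at he
  exact hw he.symm

/-- The neighbour of `x` over `w`, if `w` is adjacent to the image of `x`. -/
noncomputable def next {a : V} (x : CoverVertex G a) (w : V) : CoverVertex G a :=
  open Classical in if h : G.Adj x.proj w then (x.exists_adj_proj_eq h).choose else x

theorem adj_next {a : V} (x : CoverVertex G a) {w : V} (h : G.Adj x.proj w) :
    (universalCover G a).Adj x (x.next w) := by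
  rw [next, dif_pos h]
  exact (x.exists_adj_proj_eq h).choose_spec.1

theorem proj_next {a : V} (x : CoverVertex G a) {w : V} (h : G.Adj x.proj w) :
    (x.next w).proj = w := by
  rw [next, dif_pos h]
  exact (x.exists_adj_proj_eq h).choose_spec.2

theorem proj_adj {a : V} {x y : CoverVertex G a} (h : (universalCover G a).Adj x y) :
    G.Adj x.proj y.proj :=
  h.elim (fun k => k.adj) (fun k => k.adj.symm)

/-- The lift of `σ` to the universal covers that maps the root to `v`. -/
noncomputable def lift {a b : V} (σ : V → V) (v : CoverVertex G b) (x : CoverVertex G a) :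
    CoverVertex G b :=
  (x.walk.support.tail.map σ).foldl next v

theorem lift_root {a b : V} (σ : V → V) (v : CoverVertex G b) : lift σ v (root G a) = v := by
  simp [lift, root]

theorem IsChild.lift_eq {a b : V} (σ : V → V) (v : CoverVertex G b) {x y : CoverVertex G a}
    (h : x.IsChild y) : lift σ v y = (lift σ v x).next (σ y.proj) := by
  obtain ⟨k, e⟩ := h
  rw [lift, lift, e, SimpleGraph.Walk.support_concat,
    List.tail_append_of_ne_nil (SimpleGraph.Walk.support_ne_nil _)]
  simp

theorem proj_lift {a b : V} (σ : G ≃g G) (v : CoverVertex G b) (hv : v.proj = σ a)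
    (x : CoverVertex G a) : (lift σ v x).proj = σ x.proj := by
  induction x using induction_on_isChild with
  | base => rw [lift_root]; exact hv
  | step x y h ih =>
    rw [h.lift_eq]
    exact proj_next _ (by rw [ih]; exact σ.map_adj_iff.2 h.adj)

theorem adj_lift {a b : V} (σ : G ≃g G) (v : CoverVertex G b) (hv : v.proj = σ a)
    {x y : CoverVertex G a} (h : (universalCover G a).Adj x y) :
    (universalCover G b).Adj (lift σ v x) (lift σ v y) := by
  have key : ∀ {x y : CoverVertex G a}, x.IsChild y →
      (universalCover G b).Adj (lift σ v x) (lift σ v y) := fun {x y} h => by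
    rw [h.lift_eq]
    exact adj_next _ (by rw [proj_lift σ v hv]; exact σ.map_adj_iff.2 h.adj)
  exact h.elim key fun k => (key k).symm

/-- Uniqueness of lifts. -/
theorem eq_of_proj_eq {a b : V} {f f' : CoverVertex G a → CoverVertex G b}
    (hf : ∀ x y, (universalCover G a).Adj x y → (universalCover G b).Adj (f x) (f y))
    (hf' : ∀ x y, (universalCover G a).Adj x y → (universalCover G b).Adj (f' x) (f' y))
    (hp : ∀ x, (f x).proj = (f' x).proj) (hr : f (root G a) = f' (root G a)) : f = f' := by
  funext x
  induction x using induction_on_isChild with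
  | base => exact hr
  | step x y h ih =>
    exact proj_injOn_neighborSet (f x) (hf x y (.inl h)) (ih ▸ hf' x y (.inl h)) (hp y)

/-- The image contains `v` and is closed under adjacency: a neighbour downstairs lifts to the
source, and local injectivity of the covering map identifies its image. -/
theorem lift_surjective {a b : V} (σ : G ≃g G) (v : CoverVertex G b) (hv : v.proj = σ a)
    (hc : (universalCover G b).Connected) :
    Function.Surjective (lift σ v : CoverVertex G a → CoverVertex G b) := by
  intro z
  obtain ⟨p⟩ := hc.preconnected v z
  suffices H : ∀ {s t} (p : (universalCover G b).Walk s t),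
      (∃ x : CoverVertex G a, lift σ v x = s) → ∃ x : CoverVertex G a, lift σ v x = t from
    H p ⟨root G a, lift_root σ v⟩
  intro s t p
  induction p with
  | nil => exact id
  | @cons s m t h q ih =>
    rintro ⟨x, rfl⟩
    refine ih ?_
    have h1 : G.Adj x.proj (σ.symm m.proj) := by
      rw [← σ.map_adj_iff]
      simpa [proj_lift σ v hv] using proj_adj h
    obtain ⟨y, hy, hyp⟩ := x.exists_adj_proj_eq h1
    refine ⟨y, proj_injOn_neighborSet _ (adj_lift σ v hv hy) h ?_⟩
    rw [proj_lift σ v hv, hyp]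
    simp

theorem exists_walk_root_length_eq {a : V} (x : CoverVertex G a) :
    ∃ p : (universalCover G a).Walk (root G a) x, p.length = x.walk.length := by
  refine x.induction_on_isChild ⟨.nil, rfl⟩ fun x y h ⟨p, hp⟩ =>
    ⟨p.concat (show (universalCover G a).Adj x y from .inl h), ?_⟩
  rw [SimpleGraph.Walk.length_concat, hp, h.length_eq]

theorem universalCover_connected (a : V) : (universalCover G a).Connected :=
  haveI : Nonempty (CoverVertex G a) := ⟨root G a⟩
  ⟨fun x y => ⟨x.exists_walk_root_length_eq.choose.reverse.append y.exists_walk_root_length_eq.choose⟩⟩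

/-- For the lower bound, one step in the cover changes the length of the reduced walk by one. -/
theorem dist_root {a : V} (x : CoverVertex G a) :
    (universalCover G a).dist (root G a) x = x.walk.length := by
  obtain ⟨p, hp⟩ := x.exists_walk_root_length_eq
  refine le_antisymm (hp ▸ SimpleGraph.dist_le p) ?_
  obtain ⟨q, hq⟩ := (universalCover_connected a).exists_walk_length_eq_dist (root G a) x
  rw [← hq]
  have H : ∀ {s t} (p : (universalCover G a).Walk s t),
      t.walk.length ≤ s.walk.length + p.length := by
    intro s t p
    induction p with
    | nil => simp
    | @cons s m t h q ih =>
      rw [SimpleGraph.Walk.length_cons]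
      have : m.walk.length ≤ s.walk.length + 1 :=
        h.elim (fun k => k.length_eq.le) (fun k => by have := k.length_eq; omega)
      omega
  simpa [root] using H q

/-- Every lift of an automorphism of `G` to the universal covers is an isomorphism. -/
theorem exists_iso {a b : V} (σ : G ≃g G) (v : CoverVertex G b) (hv : v.proj = σ a) :
    ∃ e : universalCover G a ≃g universalCover G b, e (root G a) = v ∧
      ∀ x, (e x).proj = σ x.proj := by
  -- The inverse is the lift of `σ.symm` starting at a preimage `w` of the root. It is a right
  -- inverse by uniqueness of lifts, hence a left inverse because it is itself surjective.
  obtain ⟨w, hw⟩ := lift_surjective σ v hv (universalCover_connected b) (root G b)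
  have hwp : w.proj = σ.symm b := by
    rw [← σ.injective.eq_iff, ← proj_lift σ v hv, hw]
    simp [root]
  have h1 : lift σ v ∘ lift σ.symm w = (id : CoverVertex G b → CoverVertex G b) := by
    refine eq_of_proj_eq (fun x y h => adj_lift σ v hv (adj_lift σ.symm w hwp h))
      (fun x y h => h) (fun x => ?_) ?_
    · simp [proj_lift σ v hv, proj_lift σ.symm w hwp]
    · simp [lift_root, hw]
  have h2 : Function.RightInverse (lift σ.symm w : CoverVertex G b → CoverVertex G a)
      (lift σ v) := congrFun h1
  have h3 : Function.LeftInverse (lift σ.symm w : CoverVertex G b → CoverVertex G a)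
      (lift σ v) :=
    h2.rightInverse_of_surjective (lift_surjective σ.symm w hwp (universalCover_connected a))
  refine ⟨⟨⟨lift σ v, lift σ.symm w, h3, h2⟩, ?_⟩, lift_root _ _, proj_lift σ v hv⟩
  intro x y
  refine ⟨fun h => ?_, adj_lift σ v hv⟩
  have := adj_lift σ.symm w hwp h
  simpa [h3 x, h3 y] using this

/-- In the universal cover every vertex other than `y` has one neighbour that is closer to `y`;
its other neighbours are farther away from `y`. -/
theorem exists_parent {a : V} (y x : CoverVertex G a) (n : ℕ)
    (h : (universalCover G a).dist y x = n + 1) :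
    ∃ p, (universalCover G a).Adj x p ∧ (universalCover G a).dist y p = n ∧
      ∀ z, (universalCover G a).Adj x z → z ≠ p → (universalCover G a).dist y z = n + 2 := by
  -- Lifting the identity moves the base point: `y` becomes the root of the cover based at `y.proj`,
  -- where distance is walk length.
  obtain ⟨e, he, -⟩ := exists_iso (a := y.proj) .refl y rfl
  obtain ⟨x, rfl⟩ := e.surjective x
  have hd : ∀ z, (universalCover G a).dist y (e z) = z.walk.length := fun z => by
    rw [← dist_root, ← e.dist_apply, he]
  rw [hd] at h
  obtain rfl | ⟨p, hp⟩ := x.eq_root_or_exists_isChild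
  · simp [root] at h
  have := hp.length_eq
  refine ⟨e p, e.map_adj_iff.2 (.inr hp), ?_, fun z hz hne => ?_⟩
  · rw [hd]; omega
  · obtain ⟨z, rfl⟩ := e.surjective z
    rw [hd]
    rcases e.map_adj_iff.1 hz with k | k
    · rw [k.length_eq, h]
    · exact absurd (k.unique_parent hp) fun h => hne (h ▸ rfl)

theorem card_neighborFinset [Fintype V] [DecidableRel G.Adj] {a : V} (x : CoverVertex G a) :
    ((universalCover G a).neighborFinset x).card = G.degree x.proj := by
  refine Finset.card_bij (fun y _ => y.proj) ?_ ?_ ?_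
  · intro y hy
    simpa using proj_adj ((SimpleGraph.mem_neighborFinset ..).1 hy)
  · intro y hy z hz h
    exact proj_injOn_neighborSet x ((SimpleGraph.mem_neighborFinset ..).1 hy)
      ((SimpleGraph.mem_neighborFinset ..).1 hz) h
  · intro w hw
    obtain ⟨y, hy, e⟩ := x.exists_adj_proj_eq ((SimpleGraph.mem_neighborFinset ..).1 hw)
    exact ⟨y, (SimpleGraph.mem_neighborFinset ..).2 hy, e⟩

end CoverVertex

/-! ### Spheres in a rooted tree -/

namespace SimpleGraph

variable {X : Type*} {T : SimpleGraph X} {y : X}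

/-- Seen from `y` the graph `T` looks like a rooted tree: it is connected, and every other vertex
has one neighbour that is closer to `y`, while its other neighbours are farther away. -/
structure IsRootedTree (T : SimpleGraph X) (y : X) : Prop where
  connected : T.Connected
  exists_parent : ∀ x n, T.dist y x = n + 1 →
    ∃ p, T.Adj x p ∧ T.dist y p = n ∧ ∀ z, T.Adj x z → z ≠ p → T.dist y z = n + 2

variable [T.LocallyFinite]

variable (T) in
/-- The neighbours of `x` that are farther away from `y` than `x`. -/
noncomputable def children (y x : X) : Finset X :=
  (T.neighborFinset x).filter (fun z => T.dist y z = T.dist y x + 1)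

theorem mem_children {x z : X} :
    z ∈ T.children y x ↔ T.Adj x z ∧ T.dist y z = T.dist y x + 1 := by
  simp [children]

open Classical in
variable (T) in
/-- The sphere of radius `n` about `y`. -/
noncomputable def sphere (y : X) : ℕ → Finset X
  | 0 => {y}
  | n + 1 => (sphere y n).biUnion (T.children y)

namespace IsRootedTree

theorem mem_sphere (hT : T.IsRootedTree y) {n : ℕ} {x : X} :
    x ∈ T.sphere y n ↔ T.dist y x = n := by
  induction n generalizing x with
  | zero => rw [hT.connected.dist_eq_zero_iff, sphere, Finset.mem_singleton, eq_comm]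
  | succ n ih =>
    simp only [sphere, Finset.mem_biUnion, mem_children]
    constructor
    · rintro ⟨a, ha, -, h⟩
      rw [h, ih.1 ha]
    · intro h
      obtain ⟨p, hp, hd, -⟩ := hT.exists_parent x n h
      exact ⟨p, ih.2 hd, hp.symm, by rw [h, hd]⟩

theorem eq_of_mem_children (hT : T.IsRootedTree y) {x x' z : X} (h : z ∈ T.children y x)
    (h' : T.Adj z x') (hd : T.dist y x' ≤ T.dist y z) : x' = x := by
  rw [mem_children] at h
  obtain ⟨p, hp, hpd, H⟩ := hT.exists_parent z _ h.2
  have h1 : x = p := by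
    by_contra hne
    have := H x h.1.symm hne
    omega
  by_contra hne
  have := H x' h' (h1 ▸ hne)
  omega

/-- Parents are unique, so distinct vertices have disjoint sets of children. -/
theorem sum_sphere_succ (hT : T.IsRootedTree y) {M : Type*} [AddCommMonoid M] (f : X → M)
    (n : ℕ) :
    ∑ x ∈ T.sphere y (n + 1), f x = ∑ x ∈ T.sphere y n, ∑ z ∈ T.children y x, f z := by
  classical
  rw [sphere, Finset.sum_biUnion]
  intro a _ b _ hab
  rw [Function.onFun, Finset.disjoint_left]
  intro z ha hb
  have hb' := mem_children.1 hb
  exact hab (hT.eq_of_mem_children ha hb'.1.symm (by omega)).symm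

theorem neighborFinset_eq_insert [DecidableEq X] (hT : T.IsRootedTree y) {x z : X}
    (h : z ∈ T.children y x) : T.neighborFinset z = insert x (T.children y z) := by
  ext w
  rw [Finset.mem_insert, mem_children, mem_neighborFinset]
  have hz := mem_children.1 h
  constructor
  · intro hw
    refine or_iff_not_imp_left.2 fun hne => ⟨hw, ?_⟩
    obtain ⟨p, hp, hpd, H⟩ := hT.exists_parent z _ hz.2
    have hpx : p = x := hT.eq_of_mem_children h hp (by omega)
    have := H w hw (hpx ▸ hne)
    omega
  · rintro (rfl | h)
    · exact hz.1.symm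
    · exact h.1

theorem sum_neighborFinset (hT : T.IsRootedTree y) {M : Type*} [AddCommMonoid M] (f : X → M)
    {x z : X} (h : z ∈ T.children y x) :
    ∑ w ∈ T.neighborFinset z, f w = f x + ∑ w ∈ T.children y z, f w := by
  classical
  rw [hT.neighborFinset_eq_insert h, Finset.sum_insert]
  rw [mem_children] at h ⊢
  omega

theorem children_self : T.children y y = T.neighborFinset y := by
  ext z
  rw [mem_children, mem_neighborFinset, dist_self, zero_add, dist_eq_one_iff_adj, and_self]

/-- The one neighbour that is not a child is the parent. The radius is positive because `y` has no
parent. -/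
theorem card_children_add_one (hT : T.IsRootedTree y) {x : X} {n : ℕ}
    (h : x ∈ T.sphere y (n + 1)) : (T.children y x).card + 1 = (T.neighborFinset x).card := by
  simp only [sphere, Finset.mem_biUnion] at h
  obtain ⟨p, -, hx⟩ := h
  rw [Finset.card_eq_sum_ones, Finset.card_eq_sum_ones, hT.sum_neighborFinset _ hx, add_comm]

/-- If `f` sums to zero over the neighbours of every vertex, then its sums over the spheres
satisfy a recursion. -/
theorem sum_sphere_add_two (hT : T.IsRootedTree y) {f : X → ℂ}
    (hf : ∀ z, ∑ w ∈ T.neighborFinset z, f w = 0) (n : ℕ) :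
    ∑ x ∈ T.sphere y (n + 2), f x = -∑ x ∈ T.sphere y n, (T.children y x).card * f x := by
  rw [hT.sum_sphere_succ, hT.sum_sphere_succ, ← Finset.sum_neg_distrib]
  refine Finset.sum_congr rfl fun x _ => ?_
  rw [Finset.sum_congr rfl fun z hz => show _ = - f x from ?_]
  · simp
  · rw [eq_neg_iff_add_eq_zero, add_comm, ← hT.sum_neighborFinset f hz, hf]

/-! ### Degrees depending on the parity of the level -/

variable {p q : ℕ}

/-- The first factor is `-p`, all neighbours of `y` being children; each later one is `-(p-1)`. Only
degrees on even levels enter. -/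
theorem sum_sphere_even (hT : T.IsRootedTree y)
    (hp : ∀ x, Even (T.dist y x) → (T.neighborFinset x).card = p) {f : X → ℂ}
    (hf : ∀ z, ∑ w ∈ T.neighborFinset z, f w = 0) (k : ℕ) :
    ∑ x ∈ T.sphere y (2 * (k + 1)), f x = - p * (-((p : ℂ) - 1)) ^ k * f y := by
  induction k with
  | zero =>
    rw [show 2 * (0 + 1) = 0 + 2 from rfl, hT.sum_sphere_add_two hf]
    simp [sphere, children_self, ← hp y (by simp)]
  | succ k ih =>
    rw [show 2 * (k + 1 + 1) = 2 * (k + 1) + 2 from rfl, hT.sum_sphere_add_two hf]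
    have : ∀ x ∈ T.sphere y (2 * (k + 1)), ((T.children y x).card : ℂ) * f x =
        ((p : ℂ) - 1) * f x := by
      intro x hx
      have h1 := hT.card_children_add_one (n := 2 * k + 1) hx
      rw [hp x (by rw [hT.mem_sphere.1 hx]; simp)] at h1
      rw [← h1]
      push_cast
      ring
    rw [Finset.sum_congr rfl this, ← Finset.mul_sum, ih]
    ring

theorem card_sphere_succ (hT : T.IsRootedTree y) {n d : ℕ}
    (hd : ∀ x ∈ T.sphere y (n + 1), (T.neighborFinset x).card = d) :
    ((T.sphere y (n + 2)).card : ℝ) = ((d : ℝ) - 1) * (T.sphere y (n + 1)).card := by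
  rw [Finset.card_eq_sum_ones, hT.sum_sphere_succ]
  simp only [← Finset.card_eq_sum_ones]
  push_cast
  rw [Finset.sum_congr rfl fun x hx => show _ = (d : ℝ) - 1 from ?_]
  · rw [Finset.sum_const, nsmul_eq_mul, mul_comm]
  · rw [eq_sub_iff_add_eq, ← hd x hx]
    exact_mod_cast hT.card_children_add_one hx

/-- Two consecutive levels contribute one factor of each parity, in either order. Radius `0` is
excluded since `y` has `p` children, not `p - 1`. -/
theorem card_sphere_add_two (hT : T.IsRootedTree y)
    (hp : ∀ x, Even (T.dist y x) → (T.neighborFinset x).card = p)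
    (hq : ∀ x, ¬ Even (T.dist y x) → (T.neighborFinset x).card = q) (n : ℕ) :
    ((T.sphere y (n + 3)).card : ℝ) =
      ((p : ℝ) - 1) * ((q : ℝ) - 1) * (T.sphere y (n + 1)).card := by
  rcases Nat.even_or_odd n with hn | hn
  · rw [hT.card_sphere_succ (n := n + 1) (d := p)
      fun x hx => hp x (by rw [hT.mem_sphere.1 hx]; grind),
      hT.card_sphere_succ (d := q) fun x hx => hq x (by rw [hT.mem_sphere.1 hx]; grind)]
    ring
  · rw [hT.card_sphere_succ (n := n + 1) (d := q)
      fun x hx => hq x (by rw [hT.mem_sphere.1 hx]; grind),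
      hT.card_sphere_succ (d := p) fun x hx => hp x (by rw [hT.mem_sphere.1 hx]; grind)]
    ring

theorem summable_of_sphere (hT : T.IsRootedTree y) {h : X → ℝ} (h0 : ∀ x, 0 ≤ h x) {b : ℕ → ℝ}
    (hb : ∀ x, h x ≤ b (T.dist y x)) (b0 : ∀ n, 0 ≤ b n)
    (hs : Summable fun n => ((T.sphere y n).card : ℝ) * b n) : Summable h := by
  classical
  refine summable_of_sum_le h0 (c := ∑' n, ((T.sphere y n).card : ℝ) * b n) fun u => ?_
  rw [← Finset.sum_fiberwise_of_maps_to (t := u.image (T.dist y)) (g := T.dist y)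
    fun x hx => Finset.mem_image_of_mem _ hx]
  refine (Finset.sum_le_sum fun n _ => ?_).trans
    (hs.sum_le_tsum (u.image (T.dist y)) fun n _ => mul_nonneg (Nat.cast_nonneg _) (b0 n))
  calc ∑ x ∈ u with T.dist y x = n, h x ≤ ∑ x ∈ T.sphere y n, h x :=
        Finset.sum_le_sum_of_subset_of_nonneg
          (fun x hx => hT.mem_sphere.2 (Finset.mem_filter.1 hx).2) fun x _ _ => h0 x
    _ ≤ ∑ x ∈ T.sphere y n, b n :=
        Finset.sum_le_sum fun x hx => (hb x).trans_eq (by rw [hT.mem_sphere.1 hx])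
    _ = _ := by simp

theorem hasSum_sphere (hT : T.IsRootedTree y) {F : X → ℂ} {s : ℂ} (h : HasSum F s) :
    HasSum (fun n => ∑ x ∈ T.sphere y n, F x) s := by
  refine (h.tsum_fiberwise (T.dist y)).congr_fun fun n => ?_
  rw [← Finset.tsum_subtype', show (T.sphere y n : Set X) = T.dist y ⁻¹' {n} by
    ext x; simp [hT.mem_sphere]]

end IsRootedTree

/-! ### Radial functions and their pairing with functions in the kernel -/

theorem summable_of_add_two {c : ℕ → ℝ} {ρ : ℝ} (h0 : 0 ≤ ρ) (h1 : ρ < 1)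
    (h : ∀ n, c (n + 2) = ρ * c n) : Summable c := by
  have key : ∀ i k, c (2 * k + i) = ρ ^ k * c i := by
    intro i k
    induction k with
    | zero => simp
    | succ k ih => rw [show 2 * (k + 1) + i = 2 * k + i + 2 by ring, h, ih]; ring
  refine Summable.even_add_odd ?_ ?_
  · simpa only [← key 0, add_zero] using (summable_geometric_of_lt_one h0 h1).mul_right (c 0)
  · simpa only [← key 1] using (summable_geometric_of_lt_one h0 h1).mul_right (c 1)

variable (T) in
/-- The function that vanishes on the odd levels about `y` and is `t ^ k` on the level `2 k`. -/
noncomputable def radial (t : ℝ) (y x : X) : ℂ :=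
  if Even (T.dist y x) then (t : ℂ) ^ (T.dist y x / 2) else 0

namespace IsRootedTree

variable {p q : ℕ}

theorem memℓp_radial (hT : T.IsRootedTree y)
    (hp : ∀ x, Even (T.dist y x) → (T.neighborFinset x).card = p)
    (hq : ∀ x, ¬ Even (T.dist y x) → (T.neighborFinset x).card = q) {t : ℝ}
    (h0 : 0 ≤ ((p : ℝ) - 1) * ((q : ℝ) - 1) * t ^ 2)
    (h1 : ((p : ℝ) - 1) * ((q : ℝ) - 1) * t ^ 2 < 1) :
    Memℓp (T.radial t y) 2 := by
  rw [memℓp_gen_iff (by simp)]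
  -- On level `2k` the squared norm is exactly `|t| ^ (2k)`; on odd levels the bound is generous but
  -- harmless.
  refine hT.summable_of_sphere (b := fun n => |t| ^ n) (fun x => by positivity) (fun x => ?_)
    (fun n => by positivity) ?_
  · simp only [ENNReal.toReal_ofNat, Real.rpow_two, radial]
    split_ifs with hx
    · obtain ⟨k, hk⟩ := hx
      rw [hk, ← two_mul, Nat.mul_div_cancel_left _ two_pos, norm_pow, Complex.norm_real,
        Real.norm_eq_abs, ← pow_mul, mul_comm]
    · simp
  · rw [← summable_nat_add_iff 1]
    refine summable_of_add_two h0 h1 fun n => ?_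
    rw [show n + 2 + 1 = n + 3 from rfl, hT.card_sphere_add_two hp hq, ← sq_abs t]
    ring

/-- The inner product is summed sphere by sphere; the `k = 0` term `f y` is moved to the other side
because `sum_sphere_even` starts at radius `2`. -/
theorem hasSum_radial (hT : T.IsRootedTree y)
    (hp : ∀ x, Even (T.dist y x) → (T.neighborFinset x).card = p) {f : X → ℂ}
    (hf : ∀ z, ∑ w ∈ T.neighborFinset z, f w = 0) {t : ℝ} {s : ℂ}
    (h : HasSum (fun x => inner ℂ (T.radial t y x) (f x)) s) :
    HasSum (fun k : ℕ => -(t * p : ℂ) * (-(t * ((p : ℂ) - 1))) ^ k * f y) (s - f y) := by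
  have h1 := hT.hasSum_sphere h
  have h2 : HasSum (fun k : ℕ => (t : ℂ) ^ k * ∑ x ∈ T.sphere y (2 * k), f x) s := by
    rw [← (mul_right_injective₀ (two_ne_zero' ℕ)).hasSum_iff] at h1
    · refine h1.congr_fun fun k => ?_
      simp only [Function.comp_apply, Finset.mul_sum]
      refine Finset.sum_congr rfl fun x hx => ?_
      rw [radial, hT.mem_sphere.1 hx, if_pos (even_two_mul k),
        Nat.mul_div_cancel_left _ two_pos, RCLike.inner_apply, map_pow, Complex.conj_ofReal,
        mul_comm]
    · intro n hn
      refine Finset.sum_eq_zero fun x hx => ?_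
      rw [radial, if_neg, inner_zero_left]
      rw [hT.mem_sphere.1 hx]
      rintro ⟨k, rfl⟩
      exact hn ⟨k, by ring⟩
  rw [← hasSum_nat_add_iff' 1] at h2
  simp only [Finset.range_one, Finset.sum_singleton, pow_zero, one_mul, sphere] at h2
  refine h2.congr_fun fun k => ?_
  rw [hT.sum_sphere_even hp hf, neg_mul_eq_mul_neg (t : ℂ) ((p : ℂ) - 1), mul_pow]
  ring

/-- Around an even level all terms vanish. Around an odd level the parent contributes `t ^ k` and
the `q - 1` children `t ^ (k + 1)` each, which cancel by `ht`. -/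
theorem sum_neighborFinset_radial (hT : T.IsRootedTree y)
    (hq : ∀ x, ¬ Even (T.dist y x) → (T.neighborFinset x).card = q) {t : ℝ}
    (ht : 1 + ((q : ℝ) - 1) * t = 0) (z : X) :
    ∑ w ∈ T.neighborFinset z, T.radial t y w = 0 := by
  classical
  by_cases h0 : T.dist y z = 0
  · rw [hT.connected.dist_eq_zero_iff] at h0
    subst h0
    refine Finset.sum_eq_zero fun w hw => ?_
    rw [mem_neighborFinset, ← dist_eq_one_iff_adj] at hw
    simp [radial, hw]
  obtain ⟨n, hn⟩ := Nat.exists_eq_succ_of_ne_zero h0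
  obtain ⟨x, hx, hd, -⟩ := hT.exists_parent z n hn
  have hz : z ∈ T.children y x := mem_children.2 ⟨hx.symm, by omega⟩
  rw [hT.sum_neighborFinset _ hz]
  have hw : ∀ w ∈ T.children y z, T.radial t y w = t * T.radial t y x := by
    intro w hw
    have h2 : T.dist y w = n + 2 := by rw [(mem_children.1 hw).2, hn]
    simp only [radial, h2, hd, Nat.even_add, even_two, iff_true]
    split_ifs
    · rw [Nat.add_div_right _ two_pos, pow_succ']
    · simp
  rw [Finset.sum_congr rfl hw, Finset.sum_const, nsmul_eq_mul]
  by_cases he : Even n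
  · have h1 := hT.card_children_add_one (hT.mem_sphere.2 hn)
    rw [hq z (by rw [hn]; grind)] at h1
    have h3 : (1 : ℂ) + ((q : ℂ) - 1) * t = 0 := by exact_mod_cast ht
    rw [← h1] at h3
    push_cast at h3
    linear_combination T.radial t y x * h3
  · simp [radial, hd, he]

end IsRootedTree

end SimpleGraph

/-! ### The `rg`-model -/

section RGModel

variable {r g : ℕ} {x₀ : Fin r}

theorem rgTree_isRootedTree (y : RGVertex r g x₀) : (rgTree r g x₀).IsRootedTree y :=
  ⟨CoverVertex.universalCover_connected _, CoverVertex.exists_parent y⟩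

open Classical in
theorem card_neighborFinset_rgTree (x : RGVertex r g x₀) :
    ((rgTree r g x₀).neighborFinset x).card = if IsRed x then g else r := by
  rw [CoverVertex.card_neighborFinset, IsRed]
  rcases x.proj with i | i
  · have : (rgGraph r g).neighborFinset (.inl i) = Finset.univ.map .inr := by
      ext (j | j) <;> simp
    simp [← SimpleGraph.card_neighborFinset_eq_degree, this]
  · have : (rgGraph r g).neighborFinset (.inr i) = Finset.univ.map .inl := by
      ext (j | j) <;> simp
    simp [← SimpleGraph.card_neighborFinset_eq_degree, this]

theorem isRed_iff_not_of_adj {x y : RGVertex r g x₀} (h : (rgTree r g x₀).Adj x y) :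
    IsRed x ↔ ¬ IsRed y := by
  have := CoverVertex.proj_adj h
  rw [IsRed, IsRed]
  rcases hx : x.proj with i | i <;> rcases hy : y.proj with j | j <;> simp_all

theorem isRed_iff_even_dist (y x : RGVertex r g x₀) :
    IsRed x ↔ (Even ((rgTree r g x₀).dist y x) ↔ IsRed y) := by
  have hT := rgTree_isRootedTree y
  induction hn : (rgTree r g x₀).dist y x generalizing x with
  | zero => rw [hT.connected.dist_eq_zero_iff] at hn; simp [hn]
  | succ n ih =>
    obtain ⟨p, hp, hd, -⟩ := hT.exists_parent x n hn
    have h1 := isRed_iff_not_of_adj hp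
    have h2 := ih p hd
    rw [Nat.even_add_one]
    tauto

/-- A transposition of two red vertices is an automorphism of the complete bipartite graph, and its
lift can send the root to any vertex above the image of `x₀`. -/
theorem isTransitiveOnRed_top :
    IsTransitiveOnRed (⊤ : Subgroup (rgTree r g x₀ ≃g rgTree r g x₀)) := by
  have key : ∀ x : RGVertex r g x₀, IsRed x → ∃ e : rgTree r g x₀ ≃g rgTree r g x₀,
      e (CoverVertex.root _ _) = x := by
    intro x hx
    obtain ⟨i, hi⟩ := Sum.isLeft_iff.1 hx
    obtain ⟨e, he, -⟩ := CoverVertex.exists_iso (a := Sum.inl x₀)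
      (⟨Equiv.sumCongr (Equiv.swap x₀ i) (Equiv.refl (Fin g)), by
        rintro (a | a) (b | b) <;> exact Iff.rfl⟩ : rgGraph r g ≃g rgGraph r g) x (by
        rw [hi]; exact (congrArg Sum.inl (Equiv.swap_apply_left x₀ i)).symm)
    exact ⟨e, he⟩
  intro x y hx hy
  obtain ⟨e, rfl⟩ := key x hx
  obtain ⟨e', rfl⟩ := key y hy
  exact ⟨e.symm.trans e', trivial, by simp⟩

theorem rgOperator_apply (f : EllTwo (RGVertex r g x₀)) (x : RGVertex r g x₀) :
    rgOperator r g x₀ f x = ∑ y ∈ (rgTree r g x₀).neighborFinset x, f y := by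
  change jacobiAction (rgGraph r g) (Sum.inl x₀) (fun _ => 1) (fun _ => 0) f x = _
  simp [jacobiAction]

theorem rgOperator_eq_zero_iff (f : EllTwo (RGVertex r g x₀)) :
    rgOperator r g x₀ f = 0 ↔ ∀ x, ∑ y ∈ (rgTree r g x₀).neighborFinset x, f y = 0 := by
  simp only [← rgOperator_apply]
  exact ⟨fun h x => by rw [h]; rfl, fun h => lp.ext (funext h)⟩

theorem radialFunction_eq_radial (y : RGVertex r g x₀) :
    radialFunction y = (rgTree r g x₀).radial (-1 / ((r : ℝ) - 1)) y := by
  funext x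
  simp [radialFunction, SimpleGraph.radial]

theorem card_neighborFinset_of_even (y x : RGVertex r g x₀)
    (h : Even ((rgTree r g x₀).dist y x)) : ((rgTree r g x₀).neighborFinset x).card =
      ((rgTree r g x₀).neighborFinset y).card := by
  have := isRed_iff_even_dist y x
  simp only [card_neighborFinset_rgTree]
  congr 1
  simp_all

/-- The form `r + g - deg y` treats red and green centres at once. -/
theorem card_neighborFinset_of_not_even (y x : RGVertex r g x₀)
    (h : ¬ Even ((rgTree r g x₀).dist y x)) : ((rgTree r g x₀).neighborFinset x).card =
      r + g - ((rgTree r g x₀).neighborFinset y).card := by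
  have := isRed_iff_even_dist y x
  simp only [card_neighborFinset_rgTree]
  split_ifs <;> first | omega | (exfalso; tauto)

/-- For either colour of `y`, the two-level ratio is `(g-1)(r-1)/(r-1)² = (g-1)/(r-1) < 1`. -/
theorem memℓp_radialFunction (hg : 0 < g) (hgr : g < r) (y : RGVertex r g x₀) :
    Memℓp (radialFunction y) 2 := by
  rw [radialFunction_eq_radial]
  have hc : (0 : ℝ) < (r : ℝ) - 1 := by
    rw [sub_pos]; exact_mod_cast (by omega : 1 < r)
  have hg' : (1 : ℝ) ≤ g := by exact_mod_cast hg
  have hgr' : (g : ℝ) < r := by exact_mod_cast hgr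
  have h : ((((rgTree r g x₀).neighborFinset y).card : ℝ) - 1) *
      (((r + g - ((rgTree r g x₀).neighborFinset y).card : ℕ) : ℝ) - 1) *
      (-1 / ((r : ℝ) - 1)) ^ 2 = ((g : ℝ) - 1) / ((r : ℝ) - 1) := by
    have hc' := hc.ne'
    rw [card_neighborFinset_rgTree]
    split_ifs
    · rw [Nat.add_sub_cancel]; field_simp
    · rw [Nat.add_sub_cancel_left]; field_simp
  refine (rgTree_isRootedTree y).memℓp_radial (card_neighborFinset_of_even y)
    (card_neighborFinset_of_not_even y) ?_ ?_
  · rw [h]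
    exact div_nonneg (by linarith) hc.le
  · rw [h, div_lt_one hc]
    linarith

theorem hasSum_radialFunction (y : RGVertex r g x₀)
    {u φ : EllTwo (RGVertex r g x₀)} (hu : ∀ x, u x = radialFunction y x)
    (hφ : rgOperator r g x₀ φ = 0) :
    HasSum (fun k : ℕ => (((rgTree r g x₀).neighborFinset y).card / ((r : ℂ) - 1)) *
      (((((rgTree r g x₀).neighborFinset y).card : ℂ) - 1) / ((r : ℂ) - 1)) ^ k * φ y)
      (inner ℂ u φ - φ y) := by
  have h := lp.hasSum_inner (𝕜 := ℂ) u φ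
  simp only [hu, radialFunction_eq_radial] at h
  refine ((rgTree_isRootedTree y).hasSum_radial (card_neighborFinset_of_even y)
    ((rgOperator_eq_zero_iff φ).1 hφ) h).congr_fun fun k => ?_
  push_cast
  congr 2
  · ring
  · congr 1
    ring

/-- Here the degree is `r`, so the series for the inner product has constant terms `r/(r-1) φ y`,
which must tend to zero. -/
theorem apply_eq_zero_of_not_isRed (hg : 0 < g) (hgr : g < r) {y : RGVertex r g x₀}
    (hy : ¬ IsRed y) {φ : EllTwo (RGVertex r g x₀)} (hφ : rgOperator r g x₀ φ = 0) :
    φ y = 0 := by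
  have h := (hasSum_radialFunction y (u := ⟨_, memℓp_radialFunction hg hgr y⟩)
    (fun _ => rfl) hφ).summable.tendsto_atTop_zero
  have hc : (r : ℂ) - 1 ≠ 0 := by
    rw [sub_ne_zero]; exact_mod_cast (by omega : r ≠ 1)
  rw [card_neighborFinset_rgTree, if_neg hy] at h
  simp only [div_self hc, one_pow, mul_one] at h
  have h0 := tendsto_nhds_unique h tendsto_const_nhds
  have hr : (r : ℂ) ≠ 0 := by exact_mod_cast (by omega : r ≠ 0)
  simpa [hr, hc] using h0

/-- The geometric series has ratio `(g-1)/(r-1)` and sums to `g/(r-g) φ y`; the centre adds `φ y`.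
-/
theorem inner_radialFunction (hg : 0 < g) (hgr : g < r) {y : RGVertex r g x₀}
    (hy : IsRed y) {u φ : EllTwo (RGVertex r g x₀)} (hu : ∀ x, u x = radialFunction y x)
    (hφ : rgOperator r g x₀ φ = 0) :
    inner ℂ u φ = (r : ℂ) / ((r : ℂ) - g) * φ y := by
  have h := hasSum_radialFunction y hu hφ
  have hc0 : (0 : ℝ) < (r : ℝ) - 1 := by
    rw [sub_pos]; exact_mod_cast (by omega : 1 < r)
  have hg' : (1 : ℝ) ≤ g := by exact_mod_cast hg
  have hgr' : (g : ℝ) < r := by exact_mod_cast hgr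
  rw [card_neighborFinset_rgTree, if_pos hy] at h
  have hn : ‖((g : ℂ) - 1) / ((r : ℂ) - 1)‖ < 1 := by
    have : ((g : ℂ) - 1) / ((r : ℂ) - 1) = (((g : ℝ) - 1) / ((r : ℝ) - 1) : ℝ) := by
      push_cast; rfl
    rw [this, Complex.norm_real, Real.norm_of_nonneg (div_nonneg (by linarith) hc0.le),
      div_lt_one hc0]
    linarith
  have h2 := ((hasSum_geometric_of_norm_lt_one hn).mul_left
    ((g : ℂ) / ((r : ℂ) - 1))).mul_right (φ y)
  have hc : (r : ℂ) - 1 ≠ 0 := by exact_mod_cast hc0.ne'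
  have hd : (r : ℂ) - g ≠ 0 := by
    rw [sub_ne_zero]; exact_mod_cast hgr.ne'
  have h3 : 1 - ((g : ℂ) - 1) / ((r : ℂ) - 1) = ((r : ℂ) - g) / ((r : ℂ) - 1) := by
    field_simp; ring
  rw [h3] at h2
  rw [← sub_add_cancel (inner ℂ u φ) (φ y), h.unique h2]
  field_simp
  ring

/-- A red centre makes the odd levels green, of degree `r`, which matches the parameter `-1/(r-1)`.
-/
theorem rgOperator_radialFunction (hg : 0 < g) (hgr : g < r) {y : RGVertex r g x₀}
    (hy : IsRed y) {u : EllTwo (RGVertex r g x₀)} (hu : ∀ x, u x = radialFunction y x) :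
    rgOperator r g x₀ u = 0 := by
  rw [rgOperator_eq_zero_iff]
  simp only [hu, radialFunction_eq_radial]
  refine (rgTree_isRootedTree y).sum_neighborFinset_radial (q := r) (fun x hx => ?_) ?_
  · rw [card_neighborFinset_of_not_even y x hx, card_neighborFinset_rgTree, if_pos hy,
      Nat.add_sub_cancel]
  · have : (r : ℝ) - 1 ≠ 0 := by
      rw [sub_ne_zero]; exact_mod_cast (by omega : r ≠ 1)
    field_simp
    ring

/-- Since `g ≠ r`, the degree determines the colour. -/
theorem isRed_apply (hgr : g < r) (γ : rgTree r g x₀ ≃g rgTree r g x₀) {y : RGVertex r g x₀}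
    (hy : IsRed y) : IsRed (γ y) := by
  have h : ((rgTree r g x₀).neighborFinset (γ y)).card =
      ((rgTree r g x₀).neighborFinset y).card := by
    simp
  by_contra hn
  rw [card_neighborFinset_rgTree, card_neighborFinset_rgTree, if_pos hy, if_neg hn] at h
  omega

theorem ellTranslate_radialFunction {y : RGVertex r g x₀} (γ : rgTree r g x₀ ≃g rgTree r g x₀)
    {u : EllTwo (RGVertex r g x₀)} (hu : ∀ x, u x = radialFunction y x)
    (x : RGVertex r g x₀) : ellTranslate γ u x = radialFunction (γ y) x := by
  have : (rgTree r g x₀).dist (γ y) x = (rgTree r g x₀).dist y (γ.symm x) := by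
    rw [← γ.dist_apply y (γ.symm x), γ.apply_symm_apply]
  change u (γ.symm x) = _
  rw [hu, radialFunction, radialFunction, this]

theorem eq_zero_of_inner_ellTranslate_eq_zero (hg : 0 < g) (hgr : g < r)
    {o : RGVertex r g x₀} (ho : IsRed o) {u : EllTwo (RGVertex r g x₀)}
    (hu : ∀ x, u x = radialFunction o x) {S : Subgroup (rgTree r g x₀ ≃g rgTree r g x₀)}
    (hS : IsTransitiveOnRed S) {φ : EllTwo (RGVertex r g x₀)} (hφ : rgOperator r g x₀ φ = 0)
    (h : ∀ γ ∈ S, inner ℂ (ellTranslate γ u) φ = 0) : φ = 0 := by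
  ext y
  by_cases hy : IsRed y
  · obtain ⟨γ, hγ, rfl⟩ := hS o y ho hy
    have h1 := h γ hγ
    rw [inner_radialFunction hg hgr hy (ellTranslate_radialFunction γ hu) hφ] at h1
    have hr : (r : ℂ) ≠ 0 := by exact_mod_cast (by omega : r ≠ 0)
    have hd : (r : ℂ) - g ≠ 0 := by
      rw [sub_ne_zero]; exact_mod_cast hgr.ne'
    simpa [hr, hd] using h1
  · exact apply_eq_zero_of_not_isRed hg hgr hy hφ

end RGModel

theorem theorem4p1 (r g : ℕ) (hg : 0 < g) (hgr : g < r) (x₀ : Fin r)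
    (o : RGVertex r g x₀) (ho : IsRed o) :
    IsTransitiveOnRed (⊤ : Subgroup (rgTree r g x₀ ≃g rgTree r g x₀)) ∧
    ∃ u : EllTwo (RGVertex r g x₀),
      (∀ x, u x = radialFunction o x) ∧
      rgOperator r g x₀ u = 0 ∧
      ∀ S : Subgroup (rgTree r g x₀ ≃g rgTree r g x₀), IsTransitiveOnRed S →
        (Submodule.span ℂ {v | ∃ γ ∈ S, v = ellTranslate γ u}).topologicalClosure =
            LinearMap.ker (rgOperator r g x₀).toLinearMap ∧
          ∀ φ : EllTwo (RGVertex r g x₀), rgOperator r g x₀ φ = 0 →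
            (∀ γ ∈ S, inner ℂ (ellTranslate γ u) φ = 0) → φ = 0 := by
  have hu : ∀ x, (⟨_, memℓp_radialFunction hg hgr o⟩ : EllTwo (RGVertex r g x₀)) x =
    radialFunction o x := fun _ => rfl
  refine ⟨isTransitiveOnRed_top, _, hu, rgOperator_radialFunction hg hgr ho hu,
    fun S hS => ⟨?_, fun φ => eq_zero_of_inner_ellTranslate_eq_zero hg hgr ho hu hS⟩⟩
  set W := (Submodule.span ℂ {v | ∃ γ ∈ S, v = ellTranslate γ
    (⟨_, memℓp_radialFunction hg hgr o⟩ : EllTwo (RGVertex r g x₀))}).topologicalClosure with hW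
  have hle : W ≤ LinearMap.ker (rgOperator r g x₀).toLinearMap := by
    refine Submodule.topologicalClosure_minimal _ (Submodule.span_le.2 ?_)
      (rgOperator r g x₀).isClosed_ker
    rintro _ ⟨γ, -, rfl⟩
    exact rgOperator_radialFunction hg hgr (isRed_apply hgr γ ho)
      (ellTranslate_radialFunction γ hu)
  refine le_antisymm hle fun v hv => ?_
  have : CompleteSpace W := (Submodule.isClosed_topologicalClosure _).completeSpace_coe
  -- The component `z` orthogonal to `W` is again in the kernel, as `v` and `w` are, so it vanishes.
  obtain ⟨w, hw, z, hz, rfl⟩ := W.exists_add_mem_mem_orthogonal v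
  have hz0 : z = 0 := by
    refine eq_zero_of_inner_ellTranslate_eq_zero hg hgr ho hu hS ?_ fun γ hγ => ?_
    · have := Submodule.sub_mem _ hv (hle hw)
      rwa [add_sub_cancel_left] at this
    · exact hz _ (Submodule.le_topologicalClosure _ (Submodule.subset_span ⟨γ, hγ, rfl⟩))
  rwa [hz0, add_zero]
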